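/- Let $\mathbb D=\{z\in\mathbb C:|z|<1\}$ and $0\le\alpha\le 1$. For functions $g,F$ analytic in $\mathbb D$ write $g\prec F$ if $g=F\circ\omega$ on $\mathbb D$ for some analytic $\omega:\mathbb D\to\mathbb D$ with $\omega(0)=0$. Let $\mathcal{BS}(\alpha)$ be the class of all analytic functions $f$ in $\mathbb D$ with $f(0)=0$, $f'(0)=1$, $f(z)\ne 0$ for $z\in\mathbb D\setminus\{0\}$, and $$\frac{zf'(z)}{f(z)}-1\prec \frac{z}{1-\alpha z^2},$$ where $zf'(z)/f(z)$ is given the value $1$ at $z=0$. Every $f\in\mathcal{BS}(\alpha)$ has logarithmic coefficients $\gamma_n=\gamma_n(f)$, $n\ge1$, defined by $$\log\frac{f(z)}{z}=2\sum_{n=1}^{\infty}\gamma_n z^n,\qquad z\in\mathbb D,$$ where the logarithm is the analytic branch with value $0$ at $z=0$. Then: 1. For $n=1,2,3$, every $f\in\mathcal{BS}(\alpha)$ satisfies $|\gamma_n|\le \frac1{2n}$, and this is sharp: for each such $n$, equality holds for some $f\in\mathcal{BS}(\alpha)$. 2. If $\alpha\le 3-2\sqrt2$, then for every integer $n\ge1$,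 every $f\in\mathcal{BS}(\alpha)$ satisfies $|\gamma_n|\le\frac1{2n}$, and this is sharp: for each $n\ge1$, equality holds for some $f\in\mathcal{BS}(\alpha)$. 3. For every integer $n\ge1$, every $f\in\mathcal{BS}(\alpha)$ satisfies $|\gamma_n|\le\frac12$. -/

import Mathlib

/-- The open unit disk in the complex plane. -/
def unitDisk : Set ℂ := Metric.ball (0 : ℂ) 1

/-- The class `𝒜`: functions analytic in the unit disk with `f 0 = 0` and `f' 0 = 1`.
(Complex differentiability on an open set is analyticity there.) -/
def ClassA : Set (ℂ → ℂ) :=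
  {f | DifferentiableOn ℂ f unitDisk ∧ f 0 = 0 ∧ deriv f 0 = 1}

/-- Subordination `g ≺ F` in the unit disk: `g = F ∘ ω` on the disk for an analytic self-map `ω`
of the disk with `ω 0 = 0`. -/
def IsSubordinate (g F : ℂ → ℂ) : Prop :=
  ∃ ω : ℂ → ℂ, DifferentiableOn ℂ ω unitDisk ∧ Set.MapsTo ω unitDisk unitDisk ∧ ω 0 = 0 ∧
    ∀ z ∈ unitDisk, g z = F (ω z)

/-- The function `F_α(z) = z / (1 - α z²)`. -/
noncomputable def boothF (α : ℝ) (z : ℂ) : ℂ := z / (1 - (α : ℂ) * z ^ 2)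

open Classical in
/-- The function `z f'(z) / f(z)`, with its removable singularity at the origin filled in
(the limit there is `1` for every `f` in the class `𝒜`). -/
noncomputable def logDerivQuotient (f : ℂ → ℂ) (z : ℂ) : ℂ :=
  if z = 0 then 1 else z * deriv f z / f z

/-- The class `ℬ𝒮(α)`: functions `f ∈ 𝒜` with `z f'(z) / f(z) - 1 ≺ F_α(z)`. That the quotient
is a function on the disk at all (no poles) means that `f` has no zeros other than the origin. -/
def ClassBS (α : ℝ) : Set (ℂ → ℂ) :=
  {f | f ∈ ClassA ∧ (∀ z ∈ unitDisk, z ≠ 0 → f z ≠ 0) ∧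
    IsSubordinate (fun z => logDerivQuotient f z - 1) (boothF α)}

/-- `γ 1, γ 2, …` are the logarithmic coefficients of `f`:
`log (f z / z) = 2 ∑_{n ≥ 1} γ n * z ^ n` in the unit disk, where the logarithm `L` is the analytic
branch with `L 0 = 0`. The entry `γ 0` plays no role. -/
def HasLogCoeffs (f : ℂ → ℂ) (γ : ℕ → ℂ) : Prop :=
  ∃ L : ℂ → ℂ, DifferentiableOn ℂ L unitDisk ∧ L 0 = 0 ∧
    (∀ z ∈ unitDisk, z ≠ 0 → Complex.exp (L z) = f z / z) ∧
    ∀ z ∈ unitDisk, HasSum (fun n : ℕ => 2 * (γ (n + 1) * z ^ (n + 1))) (L z)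

open Complex Metric Filter Topology ComplexConjugate

/-! One bound, `|γ n| ≤ 1 / (2 n)` for all `n ≥ 1` and all `α ∈ [0, 1]`, gives every estimate. With
`L = log (f z / z)`, the function `g = z L' = F_α ∘ ω` has Taylor coefficients `2 n γ n`, which are
the averages of `z⁻ⁿ g` over `|z| = r`. Adding `α ḡ` to `g` leaves them unchanged, since `z⁻ⁿ ḡ` has
mean zero. Pointwise, `|g + α ḡ| ≤ Re H` with `H = (1 + α ω²) / (1 - α ω²)`
(`norm_boothF_add_conj_le`), and `Re H` has mean `Re H(0) = 1`. Hence `|2 n γ n| ≤ r⁻ⁿ`, and `r → 1`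
finishes. Sharpness comes from `ω = zⁿ` (`exists_norm_logCoeff_eq`). -/

lemma isOpen_unitDisk : IsOpen unitDisk := isOpen_ball

lemma zero_mem_unitDisk : (0 : ℂ) ∈ unitDisk := mem_ball_self one_pos

lemma mem_unitDisk {z : ℂ} : z ∈ unitDisk ↔ ‖z‖ < 1 := mem_ball_zero_iff

/-! ### The pointwise inequality for `F_α`. -/

lemma norm_ofReal_mul_sq_lt_one {α : ℝ} (hα0 : 0 ≤ α) (hα1 : α ≤ 1) {w : ℂ} (hw : ‖w‖ < 1) :
    ‖(α : ℂ) * w ^ 2‖ < 1 := by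
  rw [norm_mul, norm_pow, norm_real, Real.norm_of_nonneg hα0]
  nlinarith [norm_nonneg w]

lemma one_sub_mul_sq_ne_zero {α : ℝ} (hα0 : 0 ≤ α) (hα1 : α ≤ 1) {w : ℂ} (hw : ‖w‖ < 1) :
    1 - (α : ℂ) * w ^ 2 ≠ 0 := by
  intro h
  have h1 := norm_ofReal_mul_sq_lt_one hα0 hα1 hw
  rw [← sub_eq_zero.1 h] at h1
  simp at h1

/-- The boundary identity `F + α F̄ = w · Re ((1 + α w²) / (1 - α w²))` on `|w| = 1` becomes an
inequality inside the disk. -/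
lemma norm_boothF_add_conj_le {α : ℝ} (hα0 : 0 ≤ α) (hα1 : α ≤ 1) {w : ℂ} (hw : ‖w‖ < 1) :
    ‖boothF α w + α * conj (boothF α w)‖ ≤
      ((1 + (α : ℂ) * w ^ 2) / (1 - (α : ℂ) * w ^ 2)).re := by
  have hd := one_sub_mul_sq_ne_zero hα0 hα1 hw
  set d : ℂ := 1 - (α : ℂ) * w ^ 2 with hdef
  have hdc : conj d ≠ 0 := (map_ne_zero _).2 hd
  set t : ℝ := ‖w‖ with ht
  have ht0 : 0 ≤ t := norm_nonneg w
  have hww : w * conj w = ((t ^ 2 : ℝ) : ℂ) := by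
    rw [mul_conj, normSq_eq_norm_sq]
  have hdd : d * conj d = ((‖d‖ ^ 2 : ℝ) : ℂ) := by
    rw [mul_conj, normSq_eq_norm_sq]
  have hdpos : 0 < ‖d‖ ^ 2 := by positivity
  have hconj : conj d = 1 - (α : ℂ) * conj w ^ 2 := by simp [hdef]
  have e1 : boothF α w + α * conj (boothF α w) =
      (((1 - α ^ 2 * t ^ 2 : ℝ) : ℂ) * w + ((α * (1 - t ^ 2) : ℝ) : ℂ) * conj w) /
        ((‖d‖ ^ 2 : ℝ) : ℂ) := by
    rw [← hdd]
    simp only [boothF, map_div₀, ← hdef]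
    rw [mul_div_assoc', div_add_div _ _ hd hdc]
    congr 1
    rw [hconj]
    push_cast at hww ⊢
    rw [← hww, hdef]
    ring
  have e2 : ((1 + (α : ℂ) * w ^ 2) / d).re = (1 - α ^ 2 * t ^ 4) / ‖d‖ ^ 2 := by
    have h2 : (1 + (α : ℂ) * w ^ 2) / d =
        (1 + (α : ℂ) * w ^ 2) * conj d / ((‖d‖ ^ 2 : ℝ) : ℂ) := by
      rw [← hdd, mul_div_mul_right _ _ hdc]
    rw [h2, div_ofReal_re]
    congr 1
    have h3 : (1 + (α : ℂ) * w ^ 2) * conj d =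
        ((1 - α ^ 2 * t ^ 4 : ℝ) : ℂ) + ((α : ℂ) * w ^ 2 - conj ((α : ℂ) * w ^ 2)) := by
      have h4 : ((t ^ 4 : ℝ) : ℂ) = (w * conj w) ^ 2 := by rw [hww]; push_cast; ring
      push_cast at h4 ⊢
      rw [h4, hconj]
      simp only [map_mul, map_pow, conj_ofReal]
      ring
    rw [h3, add_re, ofReal_re, sub_re, conj_re, sub_self, add_zero]
  rw [e1, e2, norm_div, norm_real, Real.norm_of_nonneg hdpos.le]
  gcongr
  have hα2 : α ^ 2 * t ^ 2 ≤ 1 := by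
    rw [← mul_pow]; exact pow_le_one₀ (by positivity) (by nlinarith)
  calc _ ≤ (1 - α ^ 2 * t ^ 2) * t + (α * (1 - t ^ 2)) * t := by
        refine (norm_add_le _ _).trans_eq ?_
        rw [norm_mul, norm_mul, RCLike.norm_conj, norm_real, norm_real,
          Real.norm_of_nonneg (by linarith), Real.norm_of_nonneg]
        exact mul_nonneg hα0 (by nlinarith)
    _ ≤ 1 - α ^ 2 * t ^ 4 := by
        -- This product is exactly the right side minus the left side.
        have : 0 ≤ (1 - t) * (1 - α * t) * (1 - α * t ^ 2) := by
          have h1 : 0 ≤ 1 - α * t := by nlinarith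
          have h2 : 0 ≤ 1 - α * t ^ 2 := by nlinarith [mul_nonneg hα0 ht0]
          have h3 : 0 ≤ 1 - t := by linarith
          positivity
        linarith

/-! ### Circle averages. -/

lemma Real.norm_circleAverage_le {E : Type*} [NormedAddCommGroup E] [NormedSpace ℝ E]
    {f : ℂ → E} {u : ℂ → ℝ} {c : ℂ} {R : ℝ} (hu : CircleIntegrable u c R)
    (h : ∀ z ∈ sphere c |R|, ‖f z‖ ≤ u z) :
    ‖Real.circleAverage f c R‖ ≤ Real.circleAverage u c R := by
  rw [Real.circleAverage, Real.circleAverage, norm_smul, smul_eq_mul,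
    Real.norm_of_nonneg (by positivity)]
  gcongr
  exact intervalIntegral.norm_integral_le_of_norm_le Real.two_pi_pos.le
    (Eventually.of_forall fun θ _ => h _ (circleMap_mem_sphere' c R θ)) hu

lemma circleAverage_eq_apply_zero {g : ℂ → ℂ} (hg : DifferentiableOn ℂ g unitDisk) {r : ℝ}
    (hr0 : 0 < r) (hr1 : r < 1) : Real.circleAverage g 0 r = g 0 := by
  refine DiffContOnCl.circleAverage (DifferentiableOn.diffContOnCl (hg.mono ?_))
  rw [abs_of_pos hr0]
  exact closure_ball_subset_closedBall.trans (closedBall_subset_ball hr1)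

/-- A coefficient bound for `boothF α ∘ ω` with `ω` a Schwarz function. -/
lemma norm_circleAverage_boothF_comp_le {α : ℝ} (hα0 : 0 ≤ α) (hα1 : α ≤ 1) {ω : ℂ → ℂ}
    (hω : DifferentiableOn ℂ ω unitDisk) (hmaps : Set.MapsTo ω unitDisk unitDisk) (hω0 : ω 0 = 0)
    (n : ℕ) {r : ℝ} (hr0 : 0 < r) (hr1 : r < 1) :
    ‖Real.circleAverage (fun z => z⁻¹ ^ n * boothF α (ω z)) 0 r‖ ≤ (r ^ n)⁻¹ := by
  have hden : ∀ z ∈ unitDisk, 1 - (α : ℂ) * ω z ^ 2 ≠ 0 := fun z hz =>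
    one_sub_mul_sq_ne_zero hα0 hα1 (mem_unitDisk.1 (hmaps hz))
  have hgd : DifferentiableOn ℂ (fun z => boothF α (ω z)) unitDisk :=
    hω.div (((hω.pow 2).const_mul _).const_sub _) hden
  set g : ℂ → ℂ := fun z => boothF α (ω z) with hg
  have hg0 : g 0 = 0 := by simp [hg, hω0, boothF]
  set H : ℂ → ℂ := fun z => (1 + (α : ℂ) * ω z ^ 2) / (1 - (α : ℂ) * ω z ^ 2) with hH
  have hHd : DifferentiableOn ℂ H unitDisk :=
    (((hω.pow 2).const_mul _).const_add _).div (((hω.pow 2).const_mul _).const_sub _) hden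
  have hsub : sphere (0 : ℂ) r ⊆ unitDisk := sphere_subset_closedBall.trans
    (closedBall_subset_ball hr1)
  have hne : ∀ z ∈ sphere (0 : ℂ) r, z ≠ 0 := fun z hz => by
    rintro rfl; simp at hz; exact hr0.ne hz
  have hinv : ContinuousOn (fun z : ℂ => z⁻¹ ^ n) (sphere 0 r) :=
    (continuousOn_id.inv₀ hne).pow n
  have hgc : ContinuousOn g (sphere 0 r) := hgd.continuousOn.mono hsub
  have hi1 : CircleIntegrable (fun z => z⁻¹ ^ n * g z) 0 r :=
    (hinv.mul hgc).circleIntegrable hr0.le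
  have hi2 : CircleIntegrable (fun z => z⁻¹ ^ n * (α * conj (g z))) 0 r :=
    (hinv.mul ((continuous_conj.comp_continuousOn hgc).const_mul _)).circleIntegrable hr0.le
  have hi3 : CircleIntegrable H 0 r := (hHd.continuousOn.mono hsub).circleIntegrable hr0.le
  have hre : ContinuousOn (fun z => (H z).re) (sphere 0 r) :=
    continuous_re.comp_continuousOn (hHd.continuousOn.mono hsub)
  have hi4 : CircleIntegrable (fun z => (r ^ n)⁻¹ • (H z).re) 0 r :=
    ContinuousOn.circleIntegrable hr0.le (by fun_prop)
  have hpd : DifferentiableOn ℂ (fun z => z ^ n * g z) unitDisk :=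
    (differentiableOn_id.pow n).mul hgd
  have hi5 : CircleIntegrable (fun z => z ^ n * g z) 0 r :=
    (hpd.continuousOn.mono hsub).circleIntegrable hr0.le
  -- On `|z| = r`, `z⁻¹ = r⁻² z̄`, so the integrand is a constant times the conjugate of `zⁿ g`,
  -- which is holomorphic and vanishes at `0`; `g 0 = 0` covers `n = 0`.
  have hconj : Real.circleAverage (fun z => z⁻¹ ^ n * (α * conj (g z))) 0 r = 0 := by
    have h1 : Real.circleAverage (fun z => z⁻¹ ^ n * (α * conj (g z))) 0 r =
        Real.circleAverage
          (fun z => ((r : ℂ) ^ (2 * n))⁻¹ • ((α : ℂ) • conjCLE (z ^ n * g z))) 0 r := by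
      refine Real.circleAverage_congr_sphere fun z hz => ?_
      rw [abs_of_pos hr0] at hz
      have hz0 := hne z hz
      have hzr : ‖z‖ = r := by simpa using hz
      have hzz : z * conj z = (r : ℂ) ^ 2 := by
        rw [mul_conj, normSq_eq_norm_sq, hzr]; push_cast; rfl
      have hcz : conj z ≠ 0 := (map_ne_zero _).2 hz0
      simp only [conjCLE_apply, map_mul, map_pow, smul_eq_mul]
      rw [pow_mul, ← hzz, mul_pow, inv_pow]
      field_simp
    have h2 : Real.circleAverage (fun z => conjCLE (z ^ n * g z)) 0 r = 0 := by
      have h := conjCLE.toContinuousLinearMap.circleAverage_comp_comm hi5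
      rw [circleAverage_eq_apply_zero hpd hr0 hr1, hg0] at h
      simpa [Function.comp_def] using h
    rw [h1, Real.circleAverage_fun_smul, Real.circleAverage_fun_smul, h2, smul_zero, smul_zero]
  have hHre : Real.circleAverage (fun z => (H z).re) 0 r = 1 := by
    have h := reCLM.circleAverage_comp_comm hi3
    rw [circleAverage_eq_apply_zero hHd hr0 hr1] at h
    simpa [Function.comp_def, hH, hω0] using h
  calc ‖Real.circleAverage (fun z => z⁻¹ ^ n * g z) 0 r‖
      = ‖Real.circleAverage (fun z => z⁻¹ ^ n * g z + z⁻¹ ^ n * (α * conj (g z))) 0 r‖ := by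
        rw [Real.circleAverage_fun_add hi1 hi2, hconj, add_zero]
    _ ≤ Real.circleAverage (fun z => (r ^ n)⁻¹ • (H z).re) 0 r := by
        refine Real.norm_circleAverage_le hi4 fun z hz => ?_
        rw [abs_of_pos hr0] at hz
        have hzr : ‖z‖ = r := by simpa using hz
        rw [← mul_add, norm_mul, norm_pow, norm_inv, hzr, inv_pow, smul_eq_mul]
        gcongr
        exact norm_boothF_add_conj_le hα0 hα1 (mem_unitDisk.1 (hmaps (hsub hz)))
    _ = (r ^ n)⁻¹ := by
        rw [Real.circleAverage_fun_smul, hHre, smul_eq_mul, mul_one]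

/-! ### Logarithmic coefficients and their bound. -/

lemma coeff_eq_iteratedDeriv_div_factorial {L : ℂ → ℂ} {c : ℕ → ℂ} (hL : AnalyticAt ℂ L 0)
    (hc : ∀ z ∈ unitDisk, HasSum (fun n => c n * z ^ n) (L z)) (n : ℕ) :
    c n = iteratedDeriv n L 0 / n.factorial := by
  have h1 : HasFPowerSeriesAt L (FormalMultilinearSeries.ofScalars ℂ c) 0 := by
    rw [hasFPowerSeriesAt_iff]
    filter_upwards [isOpen_unitDisk.mem_nhds zero_mem_unitDisk] with z hz
    simpa [FormalMultilinearSeries.coeff_ofScalars, mul_comm] using hc z hz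
  have h2 := congrArg (fun p => FormalMultilinearSeries.coeff p n)
    (h1.eq_formalMultilinearSeries hL.hasFPowerSeriesAt)
  simpa [FormalMultilinearSeries.coeff_ofScalars] using h2

lemma iteratedDeriv_div_factorial_eq_circleAverage {h : ℂ → ℂ}
    (hh : DifferentiableOn ℂ h unitDisk) {r : ℝ} (hr0 : 0 < r) (hr1 : r < 1) (n : ℕ) :
    iteratedDeriv n h 0 / n.factorial = Real.circleAverage (fun z => z⁻¹ ^ n * h z) 0 r := by
  have h1 : HasFPowerSeriesAt h (cauchyPowerSeries h 0 r) 0 := by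
    lift r to NNReal using hr0.le
    exact ((hh.mono (closedBall_subset_ball hr1)).hasFPowerSeriesOnBall
      (by exact_mod_cast hr0)).hasFPowerSeriesAt
  have h2 := congrArg (fun p => FormalMultilinearSeries.coeff p n)
    ((hh.analyticAt (isOpen_unitDisk.mem_nhds
      zero_mem_unitDisk)).hasFPowerSeriesAt.eq_formalMultilinearSeries h1)
  simp only [FormalMultilinearSeries.coeff_ofScalars] at h2
  rw [h2, Real.circleAverage_eq_circleIntegral hr0.ne', FormalMultilinearSeries.coeff]
  simp [cauchyPowerSeries, mul_left_comm]

lemma logCoeff_eq_circleAverage {L : ℂ → ℂ} {γ : ℕ → ℂ} (hL : DifferentiableOn ℂ L unitDisk)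
    (hs : ∀ z ∈ unitDisk, HasSum (fun n : ℕ => 2 * (γ (n + 1) * z ^ (n + 1))) (L z))
    (n : ℕ) {r : ℝ} (hr0 : 0 < r) (hr1 : r < 1) :
    2 * ((n : ℂ) + 1) * γ (n + 1) = Real.circleAverage (fun z => z⁻¹ ^ n * deriv L z) 0 r := by
  -- `γ 0` is arbitrary, so the constant term is reset to `L 0 = 0`.
  set c : ℕ → ℂ := fun n => if n = 0 then 0 else 2 * γ n with hc
  have hcs : ∀ z ∈ unitDisk, HasSum (fun n => c n * z ^ n) (L z) := by
    intro z hz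
    rw [← hasSum_nat_add_iff' 1]
    simpa [hc, mul_assoc] using hs z hz
  have h1 := coeff_eq_iteratedDeriv_div_factorial
    (hL.analyticAt (isOpen_unitDisk.mem_nhds zero_mem_unitDisk)) hcs (n + 1)
  rw [← iteratedDeriv_div_factorial_eq_circleAverage (hL.deriv isOpen_unitDisk) hr0 hr1 n]
  have h2 : (n.factorial : ℂ) ≠ 0 := by exact_mod_cast n.factorial_ne_zero
  have h3 : (n : ℂ) + 1 ≠ 0 := by exact_mod_cast n.succ_ne_zero
  simp only [hc, Nat.succ_ne_zero, if_false, iteratedDeriv_succ', Nat.factorial_succ] at h1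
  push_cast at h1
  rw [mul_right_comm, h1]
  field_simp

lemma mul_deriv_eq_logDerivQuotient_sub_one {f L : ℂ → ℂ} (hf : DifferentiableOn ℂ f unitDisk)
    (hL : DifferentiableOn ℂ L unitDisk)
    (hexp : ∀ z ∈ unitDisk, z ≠ 0 → exp (L z) = f z / z) {z : ℂ} (hz : z ∈ unitDisk) :
    z * deriv L z = logDerivQuotient f z - 1 := by
  by_cases h0 : z = 0
  · simp [h0, logDerivQuotient]
  have hf' : HasDerivAt f (deriv f z) z :=
    (hf.differentiableAt (isOpen_unitDisk.mem_nhds hz)).hasDerivAt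
  have hL' : HasDerivAt L (deriv L z) z :=
    (hL.differentiableAt (isOpen_unitDisk.mem_nhds hz)).hasDerivAt
  have h1 := (hasDerivAt_id z).mul hL'.cexp
  have h2 : f =ᶠ[𝓝 z] (id * fun x => exp (L x)) := by
    filter_upwards [isOpen_unitDisk.mem_nhds hz, isOpen_ne.mem_nhds h0] with x hx hx0
    have hx0' : x ≠ 0 := hx0
    simp [hexp x hx hx0', mul_div_cancel₀ _ hx0']
  have h3 := hf'.unique (h1.congr_of_eventuallyEq h2)
  have h4 : f z = z * exp (L z) := by rw [hexp z hz h0, mul_div_cancel₀ _ h0]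
  have h5 := exp_ne_zero (L z)
  simp only [logDerivQuotient, if_neg h0, h3, h4, id]
  field_simp
  ring

lemma norm_logCoeff_le {α : ℝ} (hα0 : 0 ≤ α) (hα1 : α ≤ 1) {f : ℂ → ℂ} (hf : f ∈ ClassBS α)
    {γ : ℕ → ℂ} (hγ : HasLogCoeffs f γ) {n : ℕ} (hn : 1 ≤ n) :
    ‖γ n‖ ≤ 1 / (2 * (n : ℝ)) := by
  obtain ⟨⟨hfd, -, -⟩, -, ω, hω, hmaps, hω0, hsub⟩ := hf
  obtain ⟨L, hL, -, hexp, hs⟩ := hγ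
  obtain ⟨m, rfl⟩ : ∃ m, n = m + 1 := ⟨n - 1, by omega⟩
  have key : ∀ r ∈ Set.Ioo (0 : ℝ) 1, ‖2 * ((m : ℂ) + 1) * γ (m + 1)‖ ≤ (r ^ (m + 1))⁻¹ := by
    rintro r ⟨hr0, hr1⟩
    rw [logCoeff_eq_circleAverage hL hs m hr0 hr1]
    convert norm_circleAverage_boothF_comp_le hα0 hα1 hω hmaps hω0 (m + 1) hr0 hr1 using 2
    refine Real.circleAverage_congr_sphere fun z hz => ?_
    rw [abs_of_pos hr0] at hz
    have hz0 : z ≠ 0 := by rintro rfl; simp at hz; exact hr0.ne hz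
    have hzD : z ∈ unitDisk := closedBall_subset_ball hr1 (sphere_subset_closedBall hz)
    have hgz := hsub z hzD
    beta_reduce at hgz
    rw [← hgz, ← mul_deriv_eq_logDerivQuotient_sub_one hfd hL hexp hzD, pow_succ]
    field_simp
  have hlim : Tendsto (fun r : ℝ => (r ^ (m + 1))⁻¹) (𝓝[<] 1) (𝓝 1) := by
    have : ContinuousAt (fun r : ℝ => (r ^ (m + 1))⁻¹) 1 :=
      (continuousAt_id.pow _).inv₀ (by simp)
    simpa [ContinuousAt] using this.tendsto.mono_left nhdsWithin_le_nhds
  have h1 : ‖2 * ((m : ℂ) + 1) * γ (m + 1)‖ ≤ 1 :=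
    ge_of_tendsto hlim (by filter_upwards [Ioo_mem_nhdsLT zero_lt_one] with r hr using key r hr)
  have h2 : ‖2 * ((m : ℂ) + 1)‖ = 2 * ((m : ℝ) + 1) := by
    rw [norm_mul, ← Nat.cast_succ, Complex.norm_natCast]; simp
  rw [norm_mul, h2] at h1
  push_cast
  rw [le_div_iff₀ (by positivity)]
  linarith

/-! ### Existence of the coefficients and extremal functions. -/

lemma hasSum_of_differentiableOn {L : ℂ → ℂ} (hL : DifferentiableOn ℂ L unitDisk) (hL0 : L 0 = 0)
    {z : ℂ} (hz : z ∈ unitDisk) :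
    HasSum (fun n : ℕ => 2 * ((iteratedDeriv (n + 1) L 0 / (n + 1).factorial / 2) * z ^ (n + 1)))
      (L z) := by
  have h := hasSum_taylorSeries_on_ball hL hz
  rw [← hasSum_nat_add_iff' 1] at h
  simp only [Finset.range_one, Finset.sum_singleton, pow_zero, iteratedDeriv_zero, hL0, smul_zero,
    sub_zero] at h
  refine h.congr_fun fun n => ?_
  simp only [smul_eq_mul]
  ring

lemma hasLogCoeffs_of_exp_eq {f L : ℂ → ℂ} (hL : DifferentiableOn ℂ L unitDisk) (hL0 : L 0 = 0)
    (hexp : ∀ z ∈ unitDisk, z ≠ 0 → exp (L z) = f z / z) :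
    HasLogCoeffs f (fun n => iteratedDeriv n L 0 / n.factorial / 2) :=
  ⟨L, hL, hL0, hexp, fun _ hz => hasSum_of_differentiableOn hL hL0 hz⟩

/-- A zero-free holomorphic function on the disk with `k 0 = 1` has a holomorphic logarithm. -/
lemma exists_log_of_ne_zero {k : ℂ → ℂ} (hk : DifferentiableOn ℂ k unitDisk)
    (hk0 : ∀ z ∈ unitDisk, k z ≠ 0) (h1 : k 0 = 1) :
    ∃ L : ℂ → ℂ, DifferentiableOn ℂ L unitDisk ∧ L 0 = 0 ∧ ∀ z ∈ unitDisk, exp (L z) = k z := by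
  obtain ⟨L, hL0, hL⟩ :=
    (((hk.deriv isOpen_unitDisk).div hk hk0).isExactOn_ball).with_val_at 0 0
  refine ⟨L, fun z hz => (hL z hz).differentiableAt.differentiableWithinAt, hL0, fun z hz => ?_⟩
  -- `L` is the primitive of `k' / k`, so `k e^{-L}` is constant.
  have hder : ∀ x ∈ unitDisk, HasDerivAt (fun x => k x * exp (-L x)) 0 x := by
    intro x hx
    have hkx := (hk.differentiableAt (isOpen_unitDisk.mem_nhds hx)).hasDerivAt
    refine (hkx.mul (hL x hx).neg.cexp).congr_deriv ?_
    have := hk0 x hx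
    simp only [Pi.div_apply]
    field_simp
    ring
  have h2 := isOpen_unitDisk.is_const_of_deriv_eq_zero (convex_ball _ _).isPreconnected
    (fun x hx => (hder x hx).differentiableAt.differentiableWithinAt)
    (fun x hx => (hder x hx).deriv) hz zero_mem_unitDisk
  simp only [hL0, h1, neg_zero, exp_zero, mul_one, exp_neg] at h2
  exact ((mul_inv_eq_one₀ (exp_ne_zero _)).1 h2).symm

lemma exists_hasLogCoeffs {f : ℂ → ℂ} (hf : f ∈ ClassA)
    (hne : ∀ z ∈ unitDisk, z ≠ 0 → f z ≠ 0) : ∃ γ : ℕ → ℂ, HasLogCoeffs f γ := by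
  obtain ⟨hfd, hf0, hf1⟩ := hf
  -- `dslope f 0` is `f z / z` with the value `f' 0 = 1` filled in at the origin.
  have hslope : ∀ z ≠ 0, dslope f 0 z = f z / z := fun z hz => by
    rw [dslope_of_ne _ hz, slope_def_field, hf0, sub_zero, sub_zero]
  obtain ⟨L, hL, hL0, hexp⟩ := exists_log_of_ne_zero
    ((differentiableOn_dslope (isOpen_unitDisk.mem_nhds zero_mem_unitDisk)).2 hfd)
    (fun z hz => by
      by_cases h0 : z = 0
      · simp [h0, dslope_same, hf1]
      · rw [hslope z h0]; exact div_ne_zero (hne z hz h0) h0)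
    (by rw [dslope_same, hf1])
  exact ⟨_, hasLogCoeffs_of_exp_eq hL hL0 fun z hz h0 => by rw [hexp z hz, hslope z h0]⟩

/-- The function with `z f' / f - 1 = F_α (z ^ n)` attains the bound. -/
lemma exists_norm_logCoeff_eq {α : ℝ} (hα0 : 0 ≤ α) (hα1 : α ≤ 1) {n : ℕ} (hn : 1 ≤ n) :
    ∃ f ∈ ClassBS α, ∃ γ : ℕ → ℂ, HasLogCoeffs f γ ∧ ‖γ n‖ = 1 / (2 * (n : ℝ)) := by
  obtain ⟨m, rfl⟩ : ∃ m, n = m + 1 := ⟨n - 1, by omega⟩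
  have hpow : ∀ z ∈ unitDisk, z ^ (m + 1) ∈ unitDisk := fun z hz => by
    rw [mem_unitDisk, norm_pow]
    exact pow_lt_one₀ (norm_nonneg z) (mem_unitDisk.1 hz) m.succ_ne_zero
  set q : ℂ → ℂ := fun z => (1 - (α : ℂ) * (z ^ (m + 1)) ^ 2)⁻¹ with hq
  have hqd : DifferentiableOn ℂ q unitDisk := DifferentiableOn.inv (by fun_prop) fun z hz =>
    one_sub_mul_sq_ne_zero hα0 hα1 (mem_unitDisk.1 (hpow z hz))
  have hpd : DifferentiableOn ℂ (fun z => z ^ m * q z) unitDisk :=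
    (differentiableOn_id.pow m).mul hqd
  obtain ⟨L, hL0, hL⟩ := hpd.isExactOn_ball.with_val_at 0 0
  have hLd : DifferentiableOn ℂ L unitDisk := fun z hz =>
    (hL z hz).differentiableAt.differentiableWithinAt
  set f : ℂ → ℂ := fun z => z * exp (L z) with hf
  have hfd : DifferentiableOn ℂ f unitDisk := differentiableOn_id.mul hLd.cexp
  have hexp : ∀ z ∈ unitDisk, z ≠ 0 → exp (L z) = f z / z := fun z _ h0 => by
    rw [hf, mul_div_cancel_left₀ _ h0]
  have hf1 : deriv f 0 = 1 := by
    have := (hasDerivAt_id (0 : ℂ)).mul (hL 0 zero_mem_unitDisk).cexp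
    have h := this.deriv
    simp only [hL0, exp_zero, id, zero_mul, add_zero, mul_one] at h
    exact h
  have hlog := hasLogCoeffs_of_exp_eq hLd hL0 hexp
  refine ⟨f, ⟨⟨hfd, by simp [hf], hf1⟩, fun z _ h0 => mul_ne_zero h0 (exp_ne_zero _),
    fun z => z ^ (m + 1), by fun_prop, hpow, by simp, fun z hz => ?_⟩, _, hlog, ?_⟩
  · simp only
    rw [← mul_deriv_eq_logDerivQuotient_sub_one hfd hLd hexp hz, (hL z hz).deriv]
    simp only [boothF, hq]
    ring
  · set γ : ℕ → ℂ := fun n => iteratedDeriv n L 0 / n.factorial / 2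
    have h1 := logCoeff_eq_circleAverage (γ := γ) hLd
      (fun z hz => hasSum_of_differentiableOn hLd hL0 hz) m (r := 1 / 2)
      (by norm_num) (by norm_num)
    -- As `L' = z ^ m q`, the coefficient is the mean of `q`, namely `q 0 = 1`; any radius in `(0,
    -- 1)` would do.
    have h2 : Real.circleAverage (fun z => z⁻¹ ^ m * deriv L z) 0 (1 / 2) =
        Real.circleAverage q 0 (1 / 2) := by
      refine Real.circleAverage_congr_sphere fun z hz => ?_
      have hzr : ‖z‖ = 1 / 2 := by simpa using hz
      have hz0 : z ≠ 0 := norm_pos_iff.1 (by rw [hzr]; norm_num)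
      have hzD : z ∈ unitDisk := mem_unitDisk.2 (by rw [hzr]; norm_num)
      rw [(hL z hzD).deriv, ← mul_assoc, ← mul_pow, inv_mul_cancel₀ hz0, one_pow, one_mul]
    rw [h2, circleAverage_eq_apply_zero hqd (by norm_num) (by norm_num)] at h1
    have h3 : q 0 = 1 := by simp [hq]
    have h4 : ‖2 * ((m : ℂ) + 1)‖ = 2 * ((m : ℝ) + 1) := by
      rw [norm_mul, ← Nat.cast_succ, Complex.norm_natCast]; simp
    have h5 := congrArg norm h1
    rw [h3, norm_mul, h4, norm_one] at h5
    push_cast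
    rw [eq_div_iff (by positivity), mul_comm]
    exact h5

theorem theorem2p3 (α : ℝ) (hα0 : 0 ≤ α) (hα1 : α ≤ 1) :
    -- the logarithmic coefficients exist for every member of the class
    (∀ f ∈ ClassBS α, ∃ γ : ℕ → ℂ, HasLogCoeffs f γ) ∧
    -- the sharp bound for `n = 1, 2, 3`
    (∀ n : ℕ, 1 ≤ n → n ≤ 3 →
      (∀ f ∈ ClassBS α, ∀ γ : ℕ → ℂ, HasLogCoeffs f γ → ‖γ n‖ ≤ 1 / (2 * (n : ℝ))) ∧
      (∃ f ∈ ClassBS α, ∃ γ : ℕ → ℂ, HasLogCoeffs f γ ∧ ‖γ n‖ = 1 / (2 * (n : ℝ)))) ∧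
    -- the sharp bound for all `n` when `α ≤ 3 - 2√2`
    (α ≤ 3 - 2 * Real.sqrt 2 → ∀ n : ℕ, 1 ≤ n →
      (∀ f ∈ ClassBS α, ∀ γ : ℕ → ℂ, HasLogCoeffs f γ → ‖γ n‖ ≤ 1 / (2 * (n : ℝ))) ∧
      (∃ f ∈ ClassBS α, ∃ γ : ℕ → ℂ, HasLogCoeffs f γ ∧ ‖γ n‖ = 1 / (2 * (n : ℝ)))) ∧
    -- the general bound
    (∀ n : ℕ, 1 ≤ n →
      ∀ f ∈ ClassBS α, ∀ γ : ℕ → ℂ, HasLogCoeffs f γ → ‖γ n‖ ≤ 1 / 2) := by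
  refine ⟨fun f hf => exists_hasLogCoeffs hf.1 hf.2.1,
    fun n hn _ => ⟨fun f hf γ hγ => norm_logCoeff_le hα0 hα1 hf hγ hn,
      exists_norm_logCoeff_eq hα0 hα1 hn⟩,
    fun _ n hn => ⟨fun f hf γ hγ => norm_logCoeff_le hα0 hα1 hf hγ hn,
      exists_norm_logCoeff_eq hα0 hα1 hn⟩,
    fun n hn f hf γ hγ => (norm_logCoeff_le hα0 hα1 hf hγ hn).trans ?_⟩
  have hn' : (1 : ℝ) ≤ n := by exact_mod_cast hn
  gcongr
  linarith
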